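/- Let $(\Omega,\mathcal F,\mathbb P)$ be a complete probability space carrying a standard one-dimensional Brownian motion $W$, let $\mathbb F$ be the usual augmentation of the natural filtration of $W$, and let $T>0$. Let $A,C\in L^\infty(0,T;\mathbb R^{n\times n})$ and $B_i,D_i\in L^\infty(0,T;\mathbb R^{n\times m_i})$; let $G\in\mathbb R^{n\times n}$ be symmetric, $Q\in L^\infty(0,T;\mathbb R^{n\times n})$ symmetric-valued, $S_i\in L^\infty(0,T;\mathbb R^{m_i\times n})$ and $R_{ij}\in L^\infty(0,T;\mathbb R^{m_i\times m_j})$ with $R_{ij}^\top=R_{ji}$ ($i,j=1,2$), all deterministic. Let $\mathcal U_i$ be the set of $\mathbb F$-progressively measurable $\mathbb R^{m_i}$-valued processes $u$ on $[0,T]$ with $\|u\|^2:=\mathbb E\int_0^T|u(t)|^2\,dt<\infty$. For $x\in\mathbb R^n$ and $(u_1,u_2)\in\mathcal U_1\times\mathcal U_2$ let $X$ be the solution of $$dX=(AX+B_1u_1+B_2u_2)\,dt+(CX+D_1u_1+D_2u_2)\,dW,\qquad X(0)=x,$$ on $[0,T]$, and put $$J(x;u_1,u_2)=\mathbb E\Big\{\langle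 GX(T),X(T)\rangle+\int_0^T\Big\langle\begin{pmatrix}Q&S_1^\top&S_2^\top\\S_1&R_{11}&R_{12}\\S_2&R_{21}&R_{22}\end{pmatrix}\begin{pmatrix}X\\u_1\\u_2\end{pmatrix},\begin{pmatrix}X\\u_1\\u_2\end{pmatrix}\Big\rangle\,dt\Big\},$$ $$J_\lambda(x;u_1,u_2)=J(x;u_1,u_2)+\lambda\|u_1\|^2-\lambda\|u_2\|^2\qquad(\lambda>0).$$ Define, with values in $[-\infty,\infty]$, $$V^-(x)=\sup_{u_2\in\mathcal U_2}\inf_{u_1\in\mathcal U_1}J(x;u_1,u_2),\qquad V^+(x)=\inf_{u_1\in\mathcal U_1}\sup_{u_2\in\mathcal U_2}J(x;u_1,u_2),$$ and define $V_\lambda^\pm(x)$ in the same way with $J_\lambda$ in place of $J$. If $V^-(x)$ and $V^+(x)$ are finite, then $$V^-(x)\le\liminf_{\lambda\to0^+}V_\lambda^-(x)\le\limsup_{\lambda\to0^+}V_\lambda^+(x)\le V^+(x).$$ -/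

import Mathlib

open MeasureTheory ProbabilityTheory Filter Topology
open scoped NNReal ENNReal Matrix

namespace LQGame

/-! ### Brownian filtration -/

/-- The σ-algebra generated by the null sets of `μ`. -/
@[reducible]
def nullSigma {Ω : Type*} [MeasurableSpace Ω] (μ : Measure Ω) : MeasurableSpace Ω :=
  MeasurableSpace.generateFrom {s | μ s = 0}

theorem nullSigma_le {Ω : Type*} [mΩ : MeasurableSpace Ω] (μ : Measure Ω) [μ.IsComplete] :
    nullSigma μ ≤ mΩ :=
  MeasurableSpace.generateFrom_le fun s hs => Measure.IsComplete.out' s hs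

theorem stronglyMeasurable_brownian {Ω : Type*} [MeasurableSpace Ω] {μ : Measure Ω}
    [μ.IsComplete] {W : ℝ≥0 → Ω → ℝ} (hW : IsBrownianReal W μ) (t : ℝ≥0) :
    StronglyMeasurable (W t) := by
  have h : NullMeasurable (W t) μ := (hW.toIsPreBrownianReal.aemeasurable t).nullMeasurable
  exact h.measurable_of_complete.stronglyMeasurable

/-- The usual augmentation of the natural filtration of the Brownian motion `W`: the null sets are
added to `σ(W s, s ≤ t)`, and the right-continuous version is taken. -/
noncomputable def brownianFiltration {Ω : Type*} [mΩ : MeasurableSpace Ω] {μ : Measure Ω}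
    [μ.IsComplete] {W : ℝ≥0 → Ω → ℝ} (hW : IsBrownianReal W μ) : Filtration ℝ≥0 mΩ :=
  (Filtration.natural W (stronglyMeasurable_brownian hW) ⊔
    Filtration.const ℝ≥0 (nullSigma μ) (nullSigma_le μ)).rightCont

/-! ### Lebesgue measure on the time interval -/

/-- Lebesgue measure on `[0, T]`, as a measure on the time axis `ℝ≥0`. -/
noncomputable def timeMeasure (T : ℝ≥0) : Measure ℝ≥0 :=
  ((volume : Measure ℝ).restrict (Set.Icc 0 T)).map Real.toNNReal

/-! ### The Itô integral of square-integrable integrands -/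

/-- Simple integrands `φ = ∑_{i < N} ξ i · 1_{(t i, t (i+1)]}`, with `ξ i` bounded and
`F (t i)`-measurable. -/
structure SimpleIntegrand {Ω : Type*} [mΩ : MeasurableSpace Ω] (F : Filtration ℝ≥0 mΩ)
    (n : ℕ) where
  N : ℕ
  t : ℕ → ℝ≥0
  mono : Monotone t
  ξ : ℕ → Ω → EuclideanSpace ℝ (Fin n)
  meas : ∀ i, StronglyMeasurable[F (t i)] (ξ i)
  bdd : ∃ K : ℝ, ∀ i ω, ‖ξ i ω‖ ≤ K

/-- The process `φ` given by a simple integrand. -/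
noncomputable def SimpleIntegrand.process {Ω : Type*} [mΩ : MeasurableSpace Ω]
    {F : Filtration ℝ≥0 mΩ} {n : ℕ} (φ : SimpleIntegrand F n) (s : ℝ≥0) (ω : Ω) :
    EuclideanSpace ℝ (Fin n) :=
  ∑ i ∈ Finset.range φ.N, (Set.Ioc (φ.t i) (φ.t (i + 1))).indicator (fun _ => φ.ξ i ω) s

/-- The stochastic integral `∫₀ˢ φ dW` of a simple integrand. -/
noncomputable def SimpleIntegrand.integral {Ω : Type*} [mΩ : MeasurableSpace Ω]
    {F : Filtration ℝ≥0 mΩ} {n : ℕ} (φ : SimpleIntegrand F n) (W : ℝ≥0 → Ω → ℝ)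
    (s : ℝ≥0) (ω : Ω) : EuclideanSpace ℝ (Fin n) :=
  ∑ i ∈ Finset.range φ.N, (W (min (φ.t (i + 1)) s) ω - W (min (φ.t i) s) ω) • φ.ξ i ω

/-- `Y t = ∫₀ᵗ φ dW` for `t ∈ [0, T]`: `Y` is an adapted process with almost surely continuous
paths on `[0, T]` and is the `L²`-limit, at each time, of the stochastic integrals of simple
integrands that converge to `φ` in `L²([0, T] × Ω)`. -/
def IsItoIntegral {Ω : Type*} [mΩ : MeasurableSpace Ω] (μ : Measure Ω) (F : Filtration ℝ≥0 mΩ)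
    (W : ℝ≥0 → Ω → ℝ) (T : ℝ≥0) {n : ℕ} (φ Y : ℝ≥0 → Ω → EuclideanSpace ℝ (Fin n)) : Prop :=
  StronglyAdapted F Y ∧
  (∀ᵐ ω ∂μ, ContinuousOn (fun t => Y t ω) (Set.Icc 0 T)) ∧
  ∃ ψ : ℕ → SimpleIntegrand F n,
    Tendsto (fun k => eLpNorm (fun p : ℝ≥0 × Ω => (ψ k).process p.1 p.2 - φ p.1 p.2) 2
      ((timeMeasure T).prod μ)) atTop (𝓝 0) ∧
    ∀ t ≤ T, Tendsto (fun k => eLpNorm (fun ω => (ψ k).integral W t ω - Y t ω) 2 μ) atTop (𝓝 0)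

/-! ### Data of the game -/

/-- Coefficients of the state equation and weights of the quadratic functional; only their values
at times in `[0, T]` are used. -/
structure Data (n m₁ m₂ : ℕ) where
  A : ℝ≥0 → Matrix (Fin n) (Fin n) ℝ
  C : ℝ≥0 → Matrix (Fin n) (Fin n) ℝ
  B₁ : ℝ≥0 → Matrix (Fin n) (Fin m₁) ℝ
  B₂ : ℝ≥0 → Matrix (Fin n) (Fin m₂) ℝ
  D₁ : ℝ≥0 → Matrix (Fin n) (Fin m₁) ℝ
  D₂ : ℝ≥0 → Matrix (Fin n) (Fin m₂) ℝ
  G : Matrix (Fin n) (Fin n) ℝ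
  Q : ℝ≥0 → Matrix (Fin n) (Fin n) ℝ
  S₁ : ℝ≥0 → Matrix (Fin m₁) (Fin n) ℝ
  S₂ : ℝ≥0 → Matrix (Fin m₂) (Fin n) ℝ
  R₁₁ : ℝ≥0 → Matrix (Fin m₁) (Fin m₁) ℝ
  R₁₂ : ℝ≥0 → Matrix (Fin m₁) (Fin m₂) ℝ
  R₂₁ : ℝ≥0 → Matrix (Fin m₂) (Fin m₁) ℝ
  R₂₂ : ℝ≥0 → Matrix (Fin m₂) (Fin m₂) ℝ

/-- `M ∈ L^∞(0, T; ℝ^{k × l})`. -/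
def EssBounded (T : ℝ≥0) {k l : ℕ} (M : ℝ≥0 → Matrix (Fin k) (Fin l) ℝ) : Prop :=
  ∀ i j, MemLp (fun t => M t i j) ∞ (timeMeasure T)

/-- The coefficients of the state equation are Lebesgue measurable and essentially bounded. -/
structure Data.StateAssumption {n m₁ m₂ : ℕ} (d : Data n m₁ m₂) (T : ℝ≥0) : Prop where
  A : EssBounded T d.A
  C : EssBounded T d.C
  B₁ : EssBounded T d.B₁
  B₂ : EssBounded T d.B₂
  D₁ : EssBounded T d.D₁
  D₂ : EssBounded T d.D₂

/-- The weights are Lebesgue measurable, essentially bounded and symmetric. -/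
structure Data.CostAssumption {n m₁ m₂ : ℕ} (d : Data n m₁ m₂) (T : ℝ≥0) : Prop where
  Q : EssBounded T d.Q
  S₁ : EssBounded T d.S₁
  S₂ : EssBounded T d.S₂
  R₁₁ : EssBounded T d.R₁₁
  R₁₂ : EssBounded T d.R₁₂
  R₂₁ : EssBounded T d.R₂₁
  R₂₂ : EssBounded T d.R₂₂
  G_symm : d.Gᵀ = d.G
  Q_symm : ∀ t ∈ Set.Icc 0 T, (d.Q t)ᵀ = d.Q t
  R₁₁_symm : ∀ t ∈ Set.Icc 0 T, (d.R₁₁ t)ᵀ = d.R₁₁ t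
  R₁₂_symm : ∀ t ∈ Set.Icc 0 T, (d.R₁₂ t)ᵀ = d.R₂₁ t
  R₂₂_symm : ∀ t ∈ Set.Icc 0 T, (d.R₂₂ t)ᵀ = d.R₂₂ t

/-! ### Controls, state process, cost -/

/-- The controls `𝒰[0, T]`: `F`-progressively measurable processes `u` with values in `ℝᵐ` and
`E ∫₀ᵀ |u|² dt < ∞`. (A process on `[0, T]` is extended to later times in any progressively
measurable way, for instance by `0`; the values after `T` play no role.) -/
def Control {Ω : Type*} [mΩ : MeasurableSpace Ω] (μ : Measure Ω) (F : Filtration ℝ≥0 mΩ)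
    (T : ℝ≥0) (m : ℕ) : Type _ :=
  {u : ℝ≥0 → Ω → EuclideanSpace ℝ (Fin m) //
    IsStronglyProgressive F u ∧
    MemLp (fun p : ℝ≥0 × Ω => u p.1 p.2) 2 ((timeMeasure T).prod μ)}

/-- `‖u‖² = E ∫₀ᵀ |u(t)|² dt`. -/
noncomputable def Control.normSq {Ω : Type*} [mΩ : MeasurableSpace Ω] {μ : Measure Ω}
    {F : Filtration ℝ≥0 mΩ} {T : ℝ≥0} {m : ℕ} (u : Control μ F T m) : ℝ :=
  ∫ ω, ∫ t, ‖u.1 t ω‖ ^ 2 ∂(timeMeasure T) ∂μ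

section Game

variable {Ω : Type*} [mΩ : MeasurableSpace Ω] (μ : Measure Ω) (F : Filtration ℝ≥0 mΩ)
  (W : ℝ≥0 → Ω → ℝ) (T : ℝ≥0) {n m₁ m₂ : ℕ} (d : Data n m₁ m₂)

/-- `X` is a (strong, square-integrable) solution on `[0, T]` of
`dX = (A X + B₁ u₁ + B₂ u₂) dt + (C X + D₁ u₁ + D₂ u₂) dW`, `X(0) = x`. -/
def IsStateSolution (x : EuclideanSpace ℝ (Fin n)) (u₁ : Control μ F T m₁) (u₂ : Control μ F T m₂)
    (X : ℝ≥0 → Ω → EuclideanSpace ℝ (Fin n)) : Prop :=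
  IsStronglyProgressive F X ∧
  (∀ᵐ ω ∂μ, ContinuousOn (fun t => X t ω) (Set.Icc 0 T)) ∧
  MemLp (fun p : ℝ≥0 × Ω => X p.1 p.2) 2 ((timeMeasure T).prod μ) ∧
  ∃ Y : ℝ≥0 → Ω → EuclideanSpace ℝ (Fin n),
    IsItoIntegral μ F W T
      (fun t ω => (d.C t).toEuclideanLin (X t ω) + (d.D₁ t).toEuclideanLin (u₁.1 t ω)
        + (d.D₂ t).toEuclideanLin (u₂.1 t ω)) Y ∧
    ∀ᵐ ω ∂μ, ∀ t ≤ T,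
      X t ω = x + (∫ s, ((d.A s).toEuclideanLin (X s ω) + (d.B₁ s).toEuclideanLin (u₁.1 s ω)
        + (d.B₂ s).toEuclideanLin (u₂.1 s ω)) ∂(timeMeasure t)) + Y t ω

/-- The state process: the solution of the state equation, which exists and is unique up to
indistinguishability for essentially bounded coefficients. -/
noncomputable def state (x : EuclideanSpace ℝ (Fin n)) (u₁ : Control μ F T m₁)
    (u₂ : Control μ F T m₂) : ℝ≥0 → Ω → EuclideanSpace ℝ (Fin n) :=
  Classical.epsilon (IsStateSolution μ F W T d x u₁ u₂)

/-- The block matrix of running weights, acting on `(X, u₁, u₂)`. -/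
def Data.weight {n m₁ m₂ : ℕ} (d : Data n m₁ m₂) (t : ℝ≥0) :
    Matrix (Fin n ⊕ (Fin m₁ ⊕ Fin m₂)) (Fin n ⊕ (Fin m₁ ⊕ Fin m₂)) ℝ :=
  Matrix.fromBlocks (d.Q t) (Matrix.fromCols (d.S₁ t)ᵀ (d.S₂ t)ᵀ)
    (Matrix.fromRows (d.S₁ t) (d.S₂ t))
    (Matrix.fromBlocks (d.R₁₁ t) (d.R₁₂ t) (d.R₂₁ t) (d.R₂₂ t))

/-- `⟨M v, v⟩`. -/
def quadForm {ι : Type*} [Fintype ι] (M : Matrix ι ι ℝ) (v : ι → ℝ) : ℝ :=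
  (M *ᵥ v) ⬝ᵥ v

/-- The quadratic functional `J(x; u₁, u₂)`. -/
noncomputable def cost (x : EuclideanSpace ℝ (Fin n)) (u₁ : Control μ F T m₁)
    (u₂ : Control μ F T m₂) : ℝ :=
  ∫ ω, (quadForm d.G (state μ F W T d x u₁ u₂ T ω).ofLp +
    ∫ t, quadForm (d.weight t) (Sum.elim (state μ F W T d x u₁ u₂ t ω).ofLp
      (Sum.elim (u₁.1 t ω).ofLp (u₂.1 t ω).ofLp)) ∂(timeMeasure T)) ∂μ

/-- The regularized functional `J_l(x; u₁, u₂) = J(x; u₁, u₂) + l ‖u₁‖² - l ‖u₂‖²`. -/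
noncomputable def regCost (l : ℝ) (x : EuclideanSpace ℝ (Fin n)) (u₁ : Control μ F T m₁)
    (u₂ : Control μ F T m₂) : ℝ :=
  cost μ F W T d x u₁ u₂ + l * u₁.normSq - l * u₂.normSq

end Game

/-- The lower value `sup_{u₂} inf_{u₁} J(u₁, u₂)`, in the extended reals. -/
noncomputable def lowerValue {U₁ U₂ : Type*} (J : U₁ → U₂ → ℝ) : EReal :=
  ⨆ u₂, ⨅ u₁, (J u₁ u₂ : EReal)

/-- The upper value `inf_{u₁} sup_{u₂} J(u₁, u₂)`, in the extended reals. -/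
noncomputable def upperValue {U₁ U₂ : Type*} (J : U₁ → U₂ → ℝ) : EReal :=
  ⨅ u₁, ⨆ u₂, (J u₁ u₂ : EReal)

/-- An extended real number is finite. -/
def IsFiniteValue (v : EReal) : Prop := v ≠ ⊥ ∧ v ≠ ⊤

/-- `V⁻(x)`. -/
noncomputable def Vlower {Ω : Type*} [MeasurableSpace Ω] {μ : Measure Ω} [μ.IsComplete]
    {W : ℝ≥0 → Ω → ℝ} (hW : IsBrownianReal W μ) (T : ℝ≥0) {n m₁ m₂ : ℕ} (d : Data n m₁ m₂)
    (x : EuclideanSpace ℝ (Fin n)) : EReal :=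
  lowerValue (cost μ (brownianFiltration hW) W T d x)

/-- `V⁺(x)`. -/
noncomputable def Vupper {Ω : Type*} [MeasurableSpace Ω] {μ : Measure Ω} [μ.IsComplete]
    {W : ℝ≥0 → Ω → ℝ} (hW : IsBrownianReal W μ) (T : ℝ≥0) {n m₁ m₂ : ℕ} (d : Data n m₁ m₂)
    (x : EuclideanSpace ℝ (Fin n)) : EReal :=
  upperValue (cost μ (brownianFiltration hW) W T d x)

/-- `V_l⁻(x)`. -/
noncomputable def VlowerReg {Ω : Type*} [MeasurableSpace Ω] {μ : Measure Ω} [μ.IsComplete]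
    {W : ℝ≥0 → Ω → ℝ} (hW : IsBrownianReal W μ) (T : ℝ≥0) {n m₁ m₂ : ℕ} (d : Data n m₁ m₂)
    (l : ℝ) (x : EuclideanSpace ℝ (Fin n)) : EReal :=
  lowerValue (regCost μ (brownianFiltration hW) W T d l x)

/-- `V_l⁺(x)`. -/
noncomputable def VupperReg {Ω : Type*} [MeasurableSpace Ω] {μ : Measure Ω} [μ.IsComplete]
    {W : ℝ≥0 → Ω → ℝ} (hW : IsBrownianReal W μ) (T : ℝ≥0) {n m₁ m₂ : ℕ} (d : Data n m₁ m₂)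
    (l : ℝ) (x : EuclideanSpace ℝ (Fin n)) : EReal :=
  upperValue (regCost μ (brownianFiltration hW) W T d l x)

end LQGame

namespace LQGame

/-! This is a minimax argument that sees the cost only as a real function of two strategies. Fix
`u₂`: the term `l‖u₁‖²` can only raise the cost, so penalization lowers the infimum over `u₁` by at
most `l‖u₂‖²`, which vanishes as `l → 0⁺`. Since `u₂` is fixed before the limit, no uniformity over
controls is needed; the supremum over `u₂` is taken afterwards (`lowerValue_le_liminf`). Exchanging
the players gives the upper bound (`limsup_le_upperValue`), and the middle inequality is weak
duality for each `l`. -/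

theorem Control.normSq_nonneg {Ω : Type*} [mΩ : MeasurableSpace Ω] {μ : Measure Ω}
    {F : Filtration ℝ≥0 mΩ} {T : ℝ≥0} {m : ℕ} (u : Control μ F T m) : 0 ≤ u.normSq :=
  integral_nonneg fun _ => integral_nonneg fun _ => sq_nonneg _

theorem lowerValue_le_upperValue {U₁ U₂ : Type*} (J : U₁ → U₂ → ℝ) :
    lowerValue J ≤ upperValue J :=
  iSup_iInf_le_iInf_iSup fun u₂ u₁ => (J u₁ u₂ : EReal)

/-- Here `N` is the penalty of one fixed control and `δ` the error allowed; how small `l` must be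
depends on that control. -/
theorem eventually_mul_le_nhdsGT_zero (N : ℝ) {δ : ℝ} (hδ : 0 < δ) :
    ∀ᶠ l : ℝ in 𝓝[>] 0, 0 < l ∧ l * N ≤ δ := by
  have h : Tendsto (fun l : ℝ => l * N) (𝓝[>] 0) (𝓝 0) :=
    ((continuous_mul_const N).tendsto' 0 0 (zero_mul N)).mono_left nhdsWithin_le_nhds
  filter_upwards [self_mem_nhdsWithin, h.eventually (eventually_le_nhds hδ)] with l h₁ h₂
  exact ⟨h₁, h₂⟩

/-- The lower value is lower semicontinuous under vanishing penalization of both players. -/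
theorem lowerValue_le_liminf {U₁ U₂ : Type*} (J : U₁ → U₂ → ℝ) {N₁ : U₁ → ℝ} (N₂ : U₂ → ℝ)
    (hN₁ : ∀ u, 0 ≤ N₁ u) :
    lowerValue J ≤
      liminf (fun l : ℝ => lowerValue fun u₁ u₂ => J u₁ u₂ + l * N₁ u₁ - l * N₂ u₂) (𝓝[>] 0) := by
  refine iSup_le fun u₂ => le_of_forall_lt fun a ha => ?_
  -- Two real levels `a < b < c` below the infimum: `c` bounds `J · u₂` from below, the gap `c - b`
  -- absorbs `l * N₂ u₂`, and `a < b` keeps the final inequality strict. All arithmetic thus stays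
  -- in `ℝ`, even if the infimum is infinite.
  obtain ⟨b, hab, hb⟩ := EReal.lt_iff_exists_real_btwn.1 ha
  obtain ⟨c, hbc, hc⟩ := EReal.lt_iff_exists_real_btwn.1 hb
  refine hab.trans_le (le_liminf_of_le (by isBoundedDefault) ?_)
  filter_upwards [eventually_mul_le_nhdsGT_zero (N₂ u₂)
    (sub_pos.2 (EReal.coe_lt_coe_iff.1 hbc))] with l ⟨hl, hlN⟩
  -- The same `u₂` serves as competitor in the penalized game.
  refine le_iSup_of_le u₂ (le_iInf fun u₁ => EReal.coe_le_coe_iff.2 ?_)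
  have hJ : c ≤ J u₁ u₂ := EReal.coe_le_coe_iff.1 (hc.le.trans (iInf_le _ u₁))
  linarith [mul_nonneg hl.le (hN₁ u₁)]

/-- The upper value is upper semicontinuous under vanishing penalization of both players. -/
theorem limsup_le_upperValue {U₁ U₂ : Type*} (J : U₁ → U₂ → ℝ) (N₁ : U₁ → ℝ) {N₂ : U₂ → ℝ}
    (hN₂ : ∀ u, 0 ≤ N₂ u) :
    limsup (fun l : ℝ => upperValue fun u₁ u₂ => J u₁ u₂ + l * N₁ u₁ - l * N₂ u₂) (𝓝[>] 0) ≤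
      upperValue J := by
  refine le_iInf fun u₁ => le_of_forall_gt fun a ha => ?_
  -- Mirror image: `c` bounds `J u₁ ·` from above, and `b - c` absorbs `l * N₁ u₁`.
  obtain ⟨b, hb, hba⟩ := EReal.lt_iff_exists_real_btwn.1 ha
  obtain ⟨c, hc, hcb⟩ := EReal.lt_iff_exists_real_btwn.1 hb
  refine (limsup_le_of_le (by isBoundedDefault) ?_).trans_lt hba
  filter_upwards [eventually_mul_le_nhdsGT_zero (N₁ u₁)
    (sub_pos.2 (EReal.coe_lt_coe_iff.1 hcb))] with l ⟨hl, hlN⟩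
  refine iInf_le_of_le u₁ (iSup_le fun u₂ => EReal.coe_le_coe_iff.2 ?_)
  have hJ : J u₁ u₂ ≤ c :=
    EReal.coe_le_coe_iff.1 ((le_iSup (fun u₂ => (J u₁ u₂ : EReal)) u₂).trans hc.le)
  linarith [mul_nonneg hl.le (hN₂ u₂)]

end LQGame

theorem mainTheorem9 {Ω : Type*} [MeasurableSpace Ω] (μ : Measure Ω) [IsProbabilityMeasure μ]
    [μ.IsComplete] (W : ℝ≥0 → Ω → ℝ) (hW : IsBrownianReal W μ) (T : ℝ≥0) (hT : 0 < T)
    {n m₁ m₂ : ℕ} (d : LQGame.Data n m₁ m₂)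
    (hA1 : d.StateAssumption T) (hA2 : d.CostAssumption T)
    (x : EuclideanSpace ℝ (Fin n))
    (hlow : LQGame.IsFiniteValue (LQGame.Vlower hW T d x))
    (hup : LQGame.IsFiniteValue (LQGame.Vupper hW T d x)) :
    LQGame.Vlower hW T d x ≤ liminf (fun l : ℝ => LQGame.VlowerReg hW T d l x) (𝓝[>] 0) ∧
    liminf (fun l : ℝ => LQGame.VlowerReg hW T d l x) (𝓝[>] 0) ≤
      limsup (fun l : ℝ => LQGame.VupperReg hW T d l x) (𝓝[>] 0) ∧
    limsup (fun l : ℝ => LQGame.VupperReg hW T d l x) (𝓝[>] 0) ≤ LQGame.Vupper hW T d x :=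
  -- `regCost` unfolds definitionally to the penalized form `J + l * N₁ - l * N₂`.
  ⟨LQGame.lowerValue_le_liminf _ _ LQGame.Control.normSq_nonneg,
    (liminf_le_liminf (Eventually.of_forall fun _ => LQGame.lowerValue_le_upperValue _)).trans
      liminf_le_limsup,
    LQGame.limsup_le_upperValue _ _ LQGame.Control.normSq_nonneg⟩
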